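/- Let $Z_1,Z_2,\ldots$ be i.i.d. real random variables with an arbitrary common law, and let $\delta\in(0,1)$. For $i\ge 1$ let $\hat F_i(x)=\frac1i\sum_{j=1}^i \mathbb{I}_{\{Z_j\le x\}}$, and let $$\hat Q_i(p)=\sup\{x\in\mathbb{R}:\hat F_i(x)\le p\},\qquad \hat Q_i^-(p)=\sup\{x\in\mathbb{R}:\hat F_i(x)<p\}\qquad(p\in\mathbb{R})$$ be the upper and lower empirical quantile functions, with suprema taken in $[-\infty,\infty]$ (so $\sup\emptyset=-\infty$). Put $$g_i=0.85\sqrt{\tfrac1i\left[\log(\log(ei))+0.8\log(1612/\delta)\right]},$$ and, for $\alpha\in(0,1)$, let $$C^{l,\alpha}_i=\{z\in\mathbb{R}:\hat Q_i(\alpha/2-g_i)\le z\le\hat Q_i^-(1-\alpha/2+g_i)\},$$ $$\alpha^l_i(\alpha)=\sup\{\tilde\alpha\in[0,1]:\hat Q_i^-(\tilde\alpha/2+g_i)<\hat Q_i(\alpha/2-g_i)\},$$ $$\alpha^u_i(\alpha)=\sup\{\tilde\alpha\in[0,1]:\hat Q_i(1-\tilde\alpha/2-g_i)>\hat Q_i(1-\alpha/2+g_i)\},$$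 where these last two suprema are $0$ if the set is empty, and $\alpha^*_i(\alpha)=\min(\alpha^l_i(\alpha),\alpha^u_i(\alpha))$, which is a function of $Z_1,\ldots,Z_i$ (and of $\alpha,\delta$) only. Then, with probability at least $1-\delta$ over the sequence $(Z_j)_{j\ge1}$, simultaneously for all $i\ge1$ and all $\alpha\in(0,1)$, $$1-\alpha\;\le\;\mathbb{P}(Z\in C^{l,\alpha}_i\mid Z_1,\ldots,Z_i)\;\le\;1-\alpha^*_i(\alpha),$$ where $Z$ is a new observation with the same law, independent of the sequence. -/

import Mathlib

open MeasureTheory ProbabilityTheory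

noncomputable section

/-- The empirical distribution function `t ↦ (1/n) ∑ⱼ 𝟙{xⱼ ≤ t}` of a sample `x₀, …, xₙ₋₁`. -/
def empiricalCDF {n : ℕ} (x : Fin n → ℝ) (t : ℝ) : ℝ :=
  (1 / (n : ℝ)) * ∑ j : Fin n, Set.indicator (Set.Iic t) (fun _ => (1 : ℝ)) (x j)

/-- The upper quantile function `Q(p) = sup {x : F x ≤ p}`. The supremum is taken in the extended
reals, so that it is `-∞` for the empty set and `+∞` for a set that is unbounded above. -/
def upperQuantile (F : ℝ → ℝ) (p : ℝ) : EReal :=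
  sSup ((fun x : ℝ => (x : EReal)) '' {x : ℝ | F x ≤ p})

/-- The lower quantile function `Q⁻(p) = sup {x : F x < p}`, with the same convention. -/
def lowerQuantile (F : ℝ → ℝ) (p : ℝ) : EReal :=
  sSup ((fun x : ℝ => (x : EReal)) '' {x : ℝ | F x < p})

/-- The empirical upper quantile function of a sample. -/
def empUpperQuantile {n : ℕ} (x : Fin n → ℝ) (p : ℝ) : EReal :=
  upperQuantile (empiricalCDF x) p

/-- The empirical lower quantile function of a sample. -/
def empLowerQuantile {n : ℕ} (x : Fin n → ℝ) (p : ℝ) : EReal :=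
  lowerQuantile (empiricalCDF x) p

/-- The radius `g_i = 0.85 √((log log (e i) + 0.8 log (1612 / δ)) / i)`. -/
def howardRamdasRadius (δ : ℝ) (i : ℕ) : ℝ :=
  0.85 * Real.sqrt
    ((1 / (i : ℝ)) * (Real.log (Real.log (Real.exp 1 * i)) + 0.8 * Real.log (1612 / δ)))

/-- The prediction interval `[Q̂_i(α/2 - g_i), Q̂_i⁻(1 - α/2 + g_i)]`, as a set of real numbers
(its end points may be infinite). -/
def predictionInterval (δ : ℝ) {i : ℕ} (x : Fin i → ℝ) (α : ℝ) : Set ℝ :=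
  {z : ℝ | empUpperQuantile x (α / 2 - howardRamdasRadius δ i) ≤ (z : EReal) ∧
    (z : EReal) ≤ empLowerQuantile x (1 - α / 2 + howardRamdasRadius δ i)}

/-- The lower-end level `α^l_i(α)`. The set is bounded by `1`, and `sSup ∅ = 0` in `ℝ`, which is
the intended convention for the empty set. -/
def levelLower (δ : ℝ) {i : ℕ} (x : Fin i → ℝ) (α : ℝ) : ℝ :=
  sSup {a : ℝ | a ∈ Set.Icc (0 : ℝ) 1 ∧
    empLowerQuantile x (a / 2 + howardRamdasRadius δ i) <
      empUpperQuantile x (α / 2 - howardRamdasRadius δ i)}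

/-- The upper-end level `α^u_i(α)`, with the same convention. -/
def levelUpper (δ : ℝ) {i : ℕ} (x : Fin i → ℝ) (α : ℝ) : ℝ :=
  sSup {a : ℝ | a ∈ Set.Icc (0 : ℝ) 1 ∧
    empUpperQuantile x (1 - a / 2 - howardRamdasRadius δ i) >
      empUpperQuantile x (1 - α / 2 + howardRamdasRadius δ i)}

/-- The observable level `α*_i(α) = min (α^l_i(α), α^u_i(α))`, a function of the sample `x`. -/
def levelStar (δ : ℝ) {i : ℕ} (x : Fin i → ℝ) (α : ℝ) : ℝ :=
  min (levelLower δ x α) (levelUpper δ x α)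

end

/-! Let F be the distribution function of `P`. On the event that |F - F̂_i| ≤ g_i everywhere for all
i, both inequalities are deterministic. The interval misses Z on the left with probability at most
α/2 and on the right with probability at most α/2, and a union bound gives coverage. Conversely the
left and right misses have probabilities at least α^l/2 and α^u/2, and they are disjoint, so
together they have probability at least α*.

The event has probability at least 1 - δ because each one-sided deviation costs δ/2: the half-lines
(-∞, q] and (q, ∞) with q rational form two chains of sets, and right continuity passes from
rational to real thresholds. For a finite chain and a fixed sample size n, `pi_exists_frequency_le`
bounds the probability of a shortfall ε by exp(-1.76 n ε²) with no factor for the size of the chain.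
One splits by the first set that falls short and changes measure by tilting that set. The tilt
factor c = (1 - ε)/(1 + ε) is the same for every set, so all the tilted laws agree with a single one
on the information that each event uses. The disjoint events then have total tilted probability at
most one. The constant 1.76, instead of the optimal 2, is the price of this common c.

Uniformity in time comes from Doob's inequality for the submartingale (max deficit - a)⁺
(`measureReal_exists_le_visitDeficit_le`), applied on geometric epochs of ratio 1.017. The epoch
bounds decay like (1 + k log 1.017)^(-5/4) and add up to less than δ/2. -/

/-! ### The exponent of the change of measure. -/

/-- An upper bound for `log ((1 + x) / (1 - x))`. -/
theorem one_sub_mul_log_div_le {x : ℝ} (hx0 : 0 ≤ x) (hx1 : x < 1) :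
    (1 - x) * Real.log ((1 + x) / (1 - x)) ≤ 2 * x - 1.76 * x ^ 2 := by
  have hmono : MonotoneOn
      (fun y : ℝ => (2 * y - 1.76 * y ^ 2) / (1 - y) - (Real.log (1 + y) - Real.log (1 - y)))
      (Set.Ico 0 1) := by
    have hderiv : ∀ y ∈ Set.Ico (0 : ℝ) 1, HasDerivAt
        (fun y : ℝ => (2 * y - 1.76 * y ^ 2) / (1 - y) - (Real.log (1 + y) - Real.log (1 - y)))
        (((2 - 1.76 * (2 * y)) * (1 - y) - (2 * y - 1.76 * y ^ 2) * (-1)) / (1 - y) ^ 2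
          - (1 / (1 + y) - (-1) / (1 - y))) y := by
      intro y hy
      have h1 : HasDerivAt (fun y : ℝ => 1 - y) (-1) y := by
        simpa using (hasDerivAt_id y).const_sub 1
      have h2 : HasDerivAt (fun y : ℝ => 1 + y) 1 y := by
        simpa using (hasDerivAt_id y).const_add 1
      have h3 : HasDerivAt (fun y : ℝ => 2 * y - 1.76 * y ^ 2) (2 - 1.76 * (2 * y)) y := by
        have := ((hasDerivAt_id y).const_mul 2).sub (((hasDerivAt_id y).pow 2).const_mul 1.76)
        refine this.congr_deriv ?_
        simp
      have hne : (1 : ℝ) - y ≠ 0 := by linarith [hy.2]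
      have hne' : (1 : ℝ) + y ≠ 0 := by linarith [hy.1]
      exact (h3.div h1 hne).sub ((h2.log hne').sub (h1.log hne))
    refine monotoneOn_of_deriv_nonneg (convex_Ico 0 1)
      (fun y hy => (hderiv y hy).continuousAt.continuousWithinAt)
      (fun y hy => (hderiv y (interior_subset hy)).differentiableAt.differentiableWithinAt) ?_
    intro y hy
    have hy' := interior_subset hy
    rw [(hderiv y hy').deriv]
    have h1 : 0 < 1 - y := by linarith [hy'.2]
    have h2 : 0 < 1 + y := by linarith [hy'.1]
    have hkey : ((2 - 1.76 * (2 * y)) * (1 - y) - (2 * y - 1.76 * y ^ 2) * (-1)) / (1 - y) ^ 2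
          - (1 / (1 + y) - (-1) / (1 - y))
        = y * (0.48 - 1.76 * (y * (1 - y))) / ((1 - y) ^ 2 * (1 + y)) := by
      field_simp
      ring
    rw [hkey]
    -- Since y(1 - y) ≤ 1/4, the left-over is 0.48 - 0.44 = 0.04; this limits the constant 1.76.
    have : 0 ≤ 0.48 - 1.76 * (y * (1 - y)) := by nlinarith [sq_nonneg (2 * y - 1)]
    have := hy'.1
    positivity
  have h := hmono (Set.left_mem_Ico.2 one_pos) ⟨hx0, hx1⟩ hx0
  have h1 : 0 < 1 - x := by linarith
  have h2 : 0 < 1 + x := by linarith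
  simp only [mul_zero, ne_eq, OfNat.ofNat_ne_zero, not_false_eq_true, zero_pow, sub_zero,
    add_zero, Real.log_one, div_one, sub_self] at h
  rw [Real.log_div h2.ne' h1.ne', mul_comm, ← le_div_iff₀ h1]
  linarith

/-- The exponent of the tilted likelihood ratio on the event that the empirical frequency of a set
of probability `p` is at most `p - ε`. -/
theorem tilt_exponent_ge {p ε : ℝ} (hp0 : 0 ≤ p) (hp1 : p < 1) (hε0 : 0 < ε) (hε1 : ε < 1) :
    1.76 * ε ^ 2 ≤ (p - ε) * Real.log ((1 - ε) / (1 + ε)) +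
      (1 - p + ε) * Real.log ((1 - (1 - ε) / (1 + ε) * p) / (1 - p)) := by
  have h1 : 0 < 1 - ε := by linarith
  have h2 : 0 < 1 + ε := by linarith
  have h3 : 0 < 1 - p := by linarith
  have hinv : Real.log ((1 - ε) / (1 + ε)) = -Real.log ((1 + ε) / (1 - ε)) := by
    rw [← Real.log_inv, inv_div]
  have hl : 2 * ε ≤ Real.log ((1 + ε) / (1 - ε)) := by
    have := Real.le_log_one_add_of_nonneg (x := 2 * ε / (1 - ε)) (by positivity)
    have e1 : 2 * (2 * ε / (1 - ε)) / (2 * ε / (1 - ε) + 2) = 2 * ε := by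
      field_simp
      ring
    have e2 : 1 + 2 * ε / (1 - ε) = (1 + ε) / (1 - ε) := by
      field_simp
      ring
    rwa [e1, e2] at this
  -- The bound log(1 + x) ≥ 2x/(x + 2) yields the denominator 1 - p + ε, which cancels the
  -- prefactor.
  have hr : 2 * ε * p ≤
      (1 - p + ε) * Real.log ((1 - (1 - ε) / (1 + ε) * p) / (1 - p)) := by
    have := Real.le_log_one_add_of_nonneg (x := 2 * ε * p / ((1 + ε) * (1 - p))) (by positivity)
    have h4 : 0 < 1 - p + ε := by linarith
    have h5 : 1 + ε - p ≠ 0 := by linarith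
    have e1 : 2 * (2 * ε * p / ((1 + ε) * (1 - p))) / (2 * ε * p / ((1 + ε) * (1 - p)) + 2)
        = 2 * ε * p / (1 - p + ε) := by
      have : 2 * ε * p / ((1 + ε) * (1 - p)) + 2 = 2 * (1 - p + ε) / ((1 + ε) * (1 - p)) := by
        field_simp
        ring
      rw [this]
      field_simp
    have e2 : 1 + 2 * ε * p / ((1 + ε) * (1 - p)) = (1 - (1 - ε) / (1 + ε) * p) / (1 - p) := by
      field_simp
      ring
    rw [e1, e2, div_le_iff₀ h4] at this
    linarith
  have hu := one_sub_mul_log_div_le hε0.le hε1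
  rw [hinv]
  -- With ℓ = log((1 + ε)/(1 - ε)) ≥ 2ε, the lower bound εℓ - p(ℓ - 2ε) is affine and nonincreasing
  -- in p; its value at p = 1 is 2ε - (1 - ε)ℓ.
  nlinarith

/-! ### Tilted measures. -/

/-- The measure with constant densities with respect to `P` on `A` and on its complement, giving
mass `c * P A` to `A` and total mass one. -/
noncomputable def tiltedMeasure {α : Type*} [MeasurableSpace α] (P : Measure α) (c : ℝ)
    (A : Set α) : Measure α :=
  ENNReal.ofReal c • P.restrict A +
    ENNReal.ofReal ((1 - c * P.real A) / (1 - P.real A)) • P.restrict Aᶜ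

section Tilted

variable {α : Type*} [MeasurableSpace α] {P : Measure α} {c : ℝ} {A B : Set α}

theorem tiltedMeasure_apply_of_subset (hB : MeasurableSet B) (h : B ⊆ A) :
    tiltedMeasure P c A B = ENNReal.ofReal c * P B := by
  have h2 : B ∩ Aᶜ = ∅ := by
    ext x; simpa using fun hx => h hx
  simp [tiltedMeasure, Measure.restrict_apply hB, Set.inter_eq_left.2 h, h2]

theorem tiltedMeasure_apply_of_subset_compl (hB : MeasurableSet B)
    (h : B ⊆ Aᶜ) : tiltedMeasure P c A B =
      ENNReal.ofReal ((1 - c * P.real A) / (1 - P.real A)) * P B := by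
  have h2 : B ∩ A = ∅ := by
    ext x; simpa using fun hx => h hx
  simp [tiltedMeasure, Measure.restrict_apply hB, Set.inter_eq_left.2 h, h2]

theorem tiltedMeasure_compl [IsProbabilityMeasure P] (hA : MeasurableSet A) (hc0 : 0 ≤ c)
    (hc1 : c ≤ 1) (hp : P.real A < 1) :
    tiltedMeasure P c A Aᶜ = ENNReal.ofReal (1 - c * P.real A) := by
  have h0 : 0 ≤ P.real A := measureReal_nonneg
  have h1 : 0 < 1 - P.real A := by linarith
  have h2 : 0 ≤ 1 - c * P.real A := by nlinarith
  rw [tiltedMeasure_apply_of_subset_compl hA.compl subset_rfl, ← ofReal_measureReal (s := Aᶜ),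
    probReal_compl_eq_one_sub hA, ← ENNReal.ofReal_mul (by positivity)]
  congr 1
  field_simp

theorem isProbabilityMeasure_tiltedMeasure [IsProbabilityMeasure P] (hA : MeasurableSet A)
    (hc0 : 0 ≤ c) (hc1 : c ≤ 1) (hp : P.real A < 1) :
    IsProbabilityMeasure (tiltedMeasure P c A) := by
  constructor
  rw [← measure_add_measure_compl hA, tiltedMeasure_compl hA hc0 hc1 hp,
    tiltedMeasure_apply_of_subset hA subset_rfl, ← ofReal_measureReal (s := A),
    ← ENNReal.ofReal_mul hc0, ← ENNReal.ofReal_add]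
  · simp
  · have h0 : 0 ≤ P.real A := measureReal_nonneg
    positivity
  · have h0 : 0 ≤ P.real A := measureReal_nonneg
    nlinarith

end Tilted

/-! ### One-sided deviations over a finite chain, at a fixed sample size. -/

section Chain

variable {α ι : Type*} [MeasurableSpace α] [LinearOrder ι] {P : Measure α} {A : ι → Set α}

/-- The memberships of a point in the sets of a chain up to a given index. -/
def chainLabel (A : ι → Set α) (k : ι) (x : α) (i : ι) : Prop := i ≤ k ∧ x ∈ A i

theorem measurable_chainLabel (hm : ∀ i, MeasurableSet (A i)) (k : ι) :
    Measurable (chainLabel A k) :=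
  measurable_pi_lambda _ fun i => measurableSet_setOfPred.1 ((MeasurableSet.const _).inter (hm i))

variable [Fintype ι]

/-- A label up to `k` records membership in `A k`, and the tilted density depends on nothing else.
-/
theorem map_chainLabel_singleton (hm : ∀ i, MeasurableSet (A i)) (k : ι) (c : ℝ)
    (y : ι → Prop) [Decidable (y k)] :
    (tiltedMeasure P c (A k)).map (chainLabel A k) {y} =
      ENNReal.ofReal (if y k then c else (1 - c * P.real (A k)) / (1 - P.real (A k))) *
        P.map (chainLabel A k) {y} := by
  have hs := measurable_chainLabel hm k (measurableSet_singleton y)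
  rw [Measure.map_apply (measurable_chainLabel hm k) (measurableSet_singleton y),
    Measure.map_apply (measurable_chainLabel hm k) (measurableSet_singleton y)]
  split_ifs with hy
  · refine tiltedMeasure_apply_of_subset hs fun x hx => ?_
    have : chainLabel A k x = y := hx
    rw [← this] at hy
    exact hy.2
  · refine tiltedMeasure_apply_of_subset_compl hs fun x hx hxA => hy ?_
    have : chainLabel A k x = y := hx
    rw [← this]
    exact ⟨le_rfl, hxA⟩

/-- Inside `A k` both tilts multiply by the same `c`. Outside `A k` the chain property makes every
label up to `k` false, so the complement is a single atom, whose mass is forced by total mass one.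
This is what allows one tilted law to serve all sets of the chain. -/
theorem map_chainLabel_tiltedMeasure [IsProbabilityMeasure P] (hA : Monotone A)
    (hm : ∀ i, MeasurableSet (A i)) (hp : ∀ i, P.real (A i) < 1) {c : ℝ} (hc0 : 0 ≤ c)
    (hc1 : c ≤ 1) {k m : ι} (hkm : k ≤ m) :
    (tiltedMeasure P c (A m)).map (chainLabel A k) =
      (tiltedMeasure P c (A k)).map (chainLabel A k) := by
  refine Measure.ext_of_singleton fun y => ?_
  have hs := measurable_chainLabel hm k (measurableSet_singleton y)
  rw [Measure.map_apply (measurable_chainLabel hm k) (measurableSet_singleton y),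
    Measure.map_apply (measurable_chainLabel hm k) (measurableSet_singleton y)]
  by_cases hy : y k
  · have hsub : chainLabel A k ⁻¹' {y} ⊆ A k := fun x hx => by
      have : chainLabel A k x = y := hx
      rw [← this] at hy
      exact hy.2
    rw [tiltedMeasure_apply_of_subset hs hsub,
      tiltedMeasure_apply_of_subset hs (hsub.trans (hA hkm))]
  · have hfalse : ∀ x ∉ A k, chainLabel A k x = fun _ => False := by
      intro x hx
      funext i
      simp only [chainLabel, eq_iff_iff, iff_false, not_and]
      exact fun hik hxi => hx (hA hik hxi)
    have hsub : chainLabel A k ⁻¹' {y} ⊆ (A k)ᶜ := fun x hx hxA => hy <| by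
      have : chainLabel A k x = y := hx
      rw [← this]
      exact ⟨le_rfl, hxA⟩
    by_cases hyF : y = fun _ => False
    · have heq : chainLabel A k ⁻¹' {y} = (A k)ᶜ :=
        hsub.antisymm fun x hx => (hfalse x hx).trans hyF.symm
      have := isProbabilityMeasure_tiltedMeasure (P := P) (hm m) hc0 hc1 (hp m)
      have := isProbabilityMeasure_tiltedMeasure (P := P) (hm k) hc0 hc1 (hp k)
      rw [heq, prob_compl_eq_one_sub (hm k), prob_compl_eq_one_sub (hm k),
        tiltedMeasure_apply_of_subset (hm k) subset_rfl,
        tiltedMeasure_apply_of_subset (hm k) (hA hkm)]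
    · have heq : chainLabel A k ⁻¹' {y} = ∅ := by
        refine Set.eq_empty_of_forall_notMem fun x hx => hyF ?_
        rw [← hfalse x (hsub hx)]
        exact (show chainLabel A k x = y from hx).symm
      rw [heq, measure_empty, measure_empty]

open Classical in
/-- The number of coordinates that satisfy a predicate, as a real number. -/
noncomputable def countTrue {n : ℕ} (y : Fin n → Prop) : ℝ := ∑ j, if y j then 1 else 0

-- The logarithm of the product is N log c + (n - N) log r, where N is the count and r the density
-- off the set. As log c ≤ 0 ≤ log r, it is smallest at the largest allowed count n(p - ε), where it
-- equals n times the quantity bounded in `tilt_exponent_ge`.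
open Classical in
theorem one_le_exp_mul_prod_tilt {n : ℕ} (y : Fin n → Prop) {p ε : ℝ} (hp0 : 0 ≤ p) (hp1 : p < 1)
    (hε0 : 0 < ε) (hε1 : ε < 1) (h : countTrue y ≤ n * (p - ε)) :
    1 ≤ Real.exp (-(1.76 * n * ε ^ 2)) *
      ∏ j, (if y j then (1 - ε) / (1 + ε) else (1 - (1 - ε) / (1 + ε) * p) / (1 - p)) := by
  set c := (1 - ε) / (1 + ε) with hc
  set r := (1 - c * p) / (1 - p) with hr
  have hc0 : 0 < c := div_pos (by linarith) (by linarith)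
  have hc1 : c ≤ 1 := (div_le_one (by linarith)).2 (by linarith)
  have hr1 : 1 ≤ r := (one_le_div (by linarith)).2 (by nlinarith)
  have hprod : ∏ j, (if y j then c else r) =
      Real.exp (countTrue y * Real.log c + (n - countTrue y) * Real.log r) := by
    have e : ∀ j, (if y j then c else r) = Real.exp ((if y j then 1 else 0) * Real.log c +
        (1 - (if y j then 1 else 0)) * Real.log r) := by
      intro j
      split_ifs
      · simp [Real.exp_log hc0]
      · simp [Real.exp_log (zero_lt_one.trans_le hr1)]
    rw [Finset.prod_congr rfl fun j _ => e j, ← Real.exp_sum, Finset.sum_add_distrib,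
      ← Finset.sum_mul, ← Finset.sum_mul, Finset.sum_sub_distrib]
    simp [countTrue]
  rw [hprod, ← Real.exp_add]
  refine Real.one_le_exp ?_
  have hlc : Real.log c ≤ 0 := Real.log_nonpos hc0.le hc1
  have hlr : 0 ≤ Real.log r := Real.log_nonneg hr1
  have hmain := tilt_exponent_ge hp0 hp1 hε0 hε1
  rw [← hc, ← hr] at hmain
  have hn : (0 : ℝ) ≤ n := Nat.cast_nonneg n
  nlinarith [mul_nonneg (sub_nonneg.2 h) (sub_nonneg.2 (hlc.trans hlr)),
    mul_le_mul_of_nonneg_left hmain hn]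

/-- The labels of a sample for which `k` is the first set of the chain whose frequency falls short
of its probability by `ε`. -/
def firstCrossing (P : Measure α) (A : ι → Set α) (n : ℕ) (ε : ℝ) (k : ι) :
    Set (Fin n → ι → Prop) :=
  {y | countTrue (fun j => y j k) ≤ n * (P.real (A k) - ε) ∧
    ∀ i < k, ¬ countTrue (fun j => y j i) ≤ n * (P.real (A i) - ε)}

/-- The label space is finite, so the change of measure is carried out atom by atom: on the event
the likelihood ratio is at least exp(1.76 n ε²). -/
theorem pi_map_firstCrossing_le [IsProbabilityMeasure P]
    (hm : ∀ i, MeasurableSet (A i)) (hp : ∀ i, P.real (A i) < 1) (n : ℕ) {ε : ℝ} (hε0 : 0 < ε)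
    (hε1 : ε < 1) (k : ι) :
    (Measure.pi fun _ : Fin n => P.map (chainLabel A k)) (firstCrossing P A n ε k) ≤
      ENNReal.ofReal (Real.exp (-(1.76 * n * ε ^ 2))) *
        (Measure.pi fun _ : Fin n =>
          (tiltedMeasure P ((1 - ε) / (1 + ε)) (A k)).map (chainLabel A k))
          (firstCrossing P A n ε k) := by
  classical
  have hc0 : 0 ≤ (1 - ε) / (1 + ε) := div_nonneg (by linarith) (by linarith)
  have hc1 : (1 - ε) / (1 + ε) ≤ 1 := (div_le_one (by linarith)).2 (by linarith)
  have hlab := measurable_chainLabel hm k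
  have := isProbabilityMeasure_tiltedMeasure (P := P) (hm k) hc0 hc1 (hp k)
  have := Measure.isProbabilityMeasure_map (μ := P) hlab.aemeasurable
  have := Measure.isProbabilityMeasure_map
    (μ := tiltedMeasure P ((1 - ε) / (1 + ε)) (A k)) hlab.aemeasurable
  have : Fintype (Fin n → ι → Prop) := Fintype.ofFinite _
  have hfin : (firstCrossing P A n ε k) = ((firstCrossing P A n ε k).toFinset : Set _) := by simp
  rw [hfin, ← sum_measure_singleton, ← sum_measure_singleton, Finset.mul_sum]
  refine Finset.sum_le_sum fun y hy => ?_
  rw [Measure.pi_singleton, Measure.pi_singleton]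
  have hy' := (Set.mem_toFinset.1 hy).1
  have hp0 : 0 ≤ P.real (A k) := measureReal_nonneg
  have h1 := one_le_exp_mul_prod_tilt (fun j => y j k) hp0 (hp k) hε0 hε1 hy'
  simp_rw [map_chainLabel_singleton hm]
  rw [Finset.prod_mul_distrib, ← mul_assoc, ← ENNReal.ofReal_prod_of_nonneg,
    ← ENNReal.ofReal_mul (Real.exp_nonneg _)]
  · exact le_mul_of_one_le_left' (ENNReal.one_le_ofReal.2 h1)
  · intro j _
    split_ifs
    · exact hc0
    · exact div_nonneg (by linarith [mul_le_of_le_one_left hp0 hc1, hp k]) (by linarith [hp k])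

/-- A one-sided Dvoretzky–Kiefer–Wolfowitz inequality for a finite chain of sets. -/
theorem pi_exists_frequency_le [IsProbabilityMeasure P] (hA : Monotone A)
    (hm : ∀ i, MeasurableSet (A i)) (hp : ∀ i, P.real (A i) < 1) (n : ℕ) {ε : ℝ} (hε0 : 0 < ε)
    (hε1 : ε < 1) :
    (Measure.pi fun _ : Fin n => P)
      {x | ∃ k, countTrue (fun j => x j ∈ A k) ≤ n * (P.real (A k) - ε)} ≤
      ENNReal.ofReal (Real.exp (-(1.76 * n * ε ^ 2))) := by
  rcases isEmpty_or_nonempty ι with hι | hι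
  · simp
  set m : ι := Finset.univ.max' Finset.univ_nonempty
  have hle : ∀ k, k ≤ m := fun k => Finset.le_max' _ _ (Finset.mem_univ k)
  set c := (1 - ε) / (1 + ε)
  have hc0 : 0 ≤ c := div_nonneg (by linarith) (by linarith)
  have hc1 : c ≤ 1 := (div_le_one (by linarith)).2 (by linarith)
  have hQ : ∀ k, IsProbabilityMeasure (tiltedMeasure P c (A k)) := fun k =>
    isProbabilityMeasure_tiltedMeasure (hm k) hc0 hc1 (hp k)
  let lab : ι → (Fin n → α) → (Fin n → ι → Prop) := fun k x j => chainLabel A k (x j)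
  have hlab : ∀ k, Measurable (lab k) := fun k => measurable_pi_lambda _ fun j =>
    (measurable_chainLabel hm k).comp (measurable_pi_apply j)
  have hmap : ∀ (R : Measure α) [IsProbabilityMeasure R] (k : ι),
      (Measure.pi fun _ : Fin n => R).map (lab k) =
        Measure.pi fun _ : Fin n => R.map (chainLabel A k) := by
    intro R _ k
    have := Measure.isProbabilityMeasure_map (μ := R) (measurable_chainLabel hm k).aemeasurable
    exact Measure.pi_map_pi fun _ => (measurable_chainLabel hm k).aemeasurable
  let C : ι → Set (Fin n → α) := fun k => lab k ⁻¹' firstCrossing P A n ε k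
  have hdisc : ∀ s : Set (Fin n → ι → Prop), MeasurableSet s := fun s => s.toFinite.measurableSet
  have hmemC : ∀ k x, x ∈ C k ↔ (countTrue (fun j => x j ∈ A k) ≤ n * (P.real (A k) - ε) ∧
      ∀ i < k, ¬ countTrue (fun j => x j ∈ A i) ≤ n * (P.real (A i) - ε)) := by
    intro k x
    simp only [C, firstCrossing, lab, chainLabel, Set.mem_preimage, Set.mem_ofPred_eq, le_refl,
      true_and]
    refine and_congr_right fun _ => forall₂_congr fun i hi => ?_
    simp only [hi.le, true_and]
  have hmC : ∀ k, MeasurableSet (C k) := fun k => hlab k (hdisc _)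
  have hsub : {x : Fin n → α | ∃ k, countTrue (fun j => x j ∈ A k) ≤ n * (P.real (A k) - ε)} ⊆
      ⋃ k, C k := by
    rintro x hx
    classical
    let s : Finset ι := Finset.univ.filter
      fun k => countTrue (fun j => x j ∈ A k) ≤ n * (P.real (A k) - ε)
    have hs : s.Nonempty := by
      obtain ⟨k, hk⟩ := hx
      exact ⟨k, by simpa [s] using hk⟩
    refine Set.mem_iUnion.2 ⟨s.min' hs, (hmemC _ _).2 ⟨?_, fun i hi h => ?_⟩⟩
    · simpa [s] using s.min'_mem hs
    · exact absurd (s.min'_le i (by simpa [s] using h)) (not_le.2 hi)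
  have hdisj : Pairwise (Function.onFun Disjoint C) := by
    intro k l hkl
    refine Set.disjoint_left.2 fun x hxk hxl => ?_
    rw [hmemC] at hxk hxl
    rcases lt_or_gt_of_ne hkl with h | h
    · exact hxl.2 k h hxk.1
    · exact hxk.2 l h hxl.1
  -- The comparison law is tilted at the top set `m` for every `k`, so the right-hand probabilities
  -- of the disjoint `C k` sum to at most one.
  have hbound : ∀ k, (Measure.pi fun _ : Fin n => P) (C k) ≤
      ENNReal.ofReal (Real.exp (-(1.76 * n * ε ^ 2))) *
        (Measure.pi fun _ : Fin n => tiltedMeasure P c (A m)) (C k) := by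
    intro k
    rw [← Measure.map_apply (hlab k) (hdisc _), ← Measure.map_apply (hlab k) (hdisc _), hmap, hmap,
      map_chainLabel_tiltedMeasure hA hm hp hc0 hc1 (hle k)]
    exact pi_map_firstCrossing_le hm hp n hε0 hε1 k
  calc
    _ ≤ (Measure.pi fun _ : Fin n => P) (⋃ k, C k) := measure_mono hsub
    _ = ∑ k, (Measure.pi fun _ : Fin n => P) (C k) := by
        rw [measure_iUnion hdisj hmC, tsum_fintype]
    _ ≤ ∑ k, ENNReal.ofReal (Real.exp (-(1.76 * n * ε ^ 2))) *
        (Measure.pi fun _ : Fin n => tiltedMeasure P c (A m)) (C k) :=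
        Finset.sum_le_sum fun k _ => hbound k
    _ = ENNReal.ofReal (Real.exp (-(1.76 * n * ε ^ 2))) *
        (Measure.pi fun _ : Fin n => tiltedMeasure P c (A m)) (⋃ k, C k) := by
        rw [← Finset.mul_sum, measure_iUnion hdisj hmC, tsum_fintype]
    _ ≤ ENNReal.ofReal (Real.exp (-(1.76 * n * ε ^ 2))) := mul_le_of_le_one_right' prob_le_one

end Chain

/-! ### From a fixed sample size to a maximal inequality. Index `i` means `i + 1` observations. -/

section Deficit

variable {Ω : Type*} {P : Measure ℝ} {Z : ℕ → Ω → ℝ} {ι : Type*} {A : ι → Set ℝ}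

/-- The expected minus the actual number of visits of `Z 0, …, Z i` to a set `S`. -/
noncomputable def visitDeficit (P : Measure ℝ) (Z : ℕ → Ω → ℝ) (S : Set ℝ) (i : ℕ) (ω : Ω) : ℝ :=
  ∑ j ∈ Finset.range (i + 1), (P.real S - S.indicator (fun _ => (1 : ℝ)) (Z j ω))

theorem visitDeficit_eq (P : Measure ℝ) (Z : ℕ → Ω → ℝ) (S : Set ℝ) (i : ℕ) (ω : Ω) :
    visitDeficit P Z S i ω =
      ((i + 1 : ℕ) : ℝ) * P.real S - countTrue (fun j : Fin (i + 1) => Z j ω ∈ S) := by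
  classical
  rw [visitDeficit, Finset.sum_sub_distrib, Finset.sum_const, Finset.card_range, nsmul_eq_mul,
    Finset.sum_range, countTrue]
  simp [Set.indicator_apply]

/-- The largest visit deficit over a finite family of sets. -/
noncomputable def maxDeficit [Fintype ι] [Nonempty ι] (P : Measure ℝ) (Z : ℕ → Ω → ℝ)
    (A : ι → Set ℝ) : ℕ → Ω → ℝ :=
  Finset.univ.sup' Finset.univ_nonempty fun k => visitDeficit P Z (A k)

theorem lt_maxDeficit_iff [Fintype ι] [Nonempty ι] {i : ℕ} {ω : Ω} {u : ℝ} :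
    u < maxDeficit P Z A i ω ↔ ∃ k, u < visitDeficit P Z (A k) i ω := by
  simp [maxDeficit, Finset.sup'_apply, Finset.lt_sup'_iff]

theorem le_maxDeficit_iff [Fintype ι] [Nonempty ι] {i : ℕ} {ω : Ω} {u : ℝ} :
    u ≤ maxDeficit P Z A i ω ↔ ∃ k, u ≤ visitDeficit P Z (A k) i ω := by
  simp [maxDeficit, Finset.sup'_apply, Finset.le_sup'_iff]

/-- The excess over `a` of the largest visit deficit. -/
noncomputable def excessDeficit [Fintype ι] [Nonempty ι] (P : Measure ℝ) (Z : ℕ → Ω → ℝ)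
    (A : ι → Set ℝ) (a : ℝ) : ℕ → Ω → ℝ :=
  (maxDeficit P Z A - fun _ _ => a)⁺

theorem stronglyMeasurable_deficitTerm {m : MeasurableSpace Ω} {X : Ω → ℝ} (hX : Measurable[m] X)
    {S : Set ℝ} (hS : MeasurableSet S) :
    StronglyMeasurable[m] fun ω => P.real S - S.indicator (fun _ => (1 : ℝ)) (X ω) :=
  (((measurable_const (a := P.real S)).sub
    ((measurable_const (a := (1 : ℝ))).indicator hS)).comp hX).stronglyMeasurable

variable [MeasurableSpace Ω] {μ : Measure Ω} [IsProbabilityMeasure μ]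

theorem integrable_deficitTerm {X : Ω → ℝ} (hX : Measurable X) {S : Set ℝ}
    (hS : MeasurableSet S) :
    Integrable (fun ω => P.real S - S.indicator (fun _ => (1 : ℝ)) (X ω)) μ := by
  refine (integrable_const _).sub ?_
  exact (integrable_const (1 : ℝ)).indicator (hX hS)

theorem integral_deficitTerm {X : Ω → ℝ} (hX : Measurable X) (hlaw : μ.map X = P) {S : Set ℝ}
    (hS : MeasurableSet S) :
    ∫ ω, (P.real S - S.indicator (fun _ => (1 : ℝ)) (X ω)) ∂μ = 0 := by
  have h : (fun ω => S.indicator (fun _ => (1 : ℝ)) (X ω)) =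
      (X ⁻¹' S).indicator (fun _ => (1 : ℝ)) := rfl
  rw [integral_sub (integrable_const _) (by rw [h]; exact (integrable_const _).indicator (hX hS)),
    h, integral_indicator (hX hS)]
  simp [← hlaw, measureReal_def, Measure.map_apply hX hS]

theorem martingale_visitDeficit (hZ : ∀ n, Measurable (Z n)) (hlaw : ∀ n, μ.map (Z n) = P)
    (hindep : iIndepFun Z μ) {S : Set ℝ} (hS : MeasurableSet S) :
    Martingale (visitDeficit P Z S)
      (Filtration.natural Z fun n => (hZ n).stronglyMeasurable) μ := by
  set 𝒢 := Filtration.natural Z fun n => (hZ n).stronglyMeasurable with h𝒢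
  have hadZ := Filtration.stronglyAdapted_natural fun n => (hZ n).stronglyMeasurable
  have hterm : ∀ i j, j ≤ i → StronglyMeasurable[𝒢 i]
      fun ω => P.real S - S.indicator (fun _ => (1 : ℝ)) (Z j ω) := fun i j hji =>
    stronglyMeasurable_deficitTerm (((hadZ j).mono (𝒢.mono hji)).measurable) hS
  have hadp : StronglyAdapted 𝒢 (visitDeficit P Z S) := by
    intro i
    unfold visitDeficit
    exact Finset.stronglyMeasurable_fun_sum _ fun j hj =>
      hterm i j (Nat.lt_succ_iff.1 (Finset.mem_range.1 hj))
  have hint : ∀ i, Integrable (visitDeficit P Z S i) μ := fun i =>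
    integrable_finsetSum _ fun j _ => integrable_deficitTerm (hZ j) hS
  refine martingale_nat hadp hint fun i => ?_
  have hsucc : visitDeficit P Z S (i + 1) = visitDeficit P Z S i +
      fun ω => P.real S - S.indicator (fun _ => (1 : ℝ)) (Z (i + 1) ω) := by
    funext ω
    exact Finset.sum_range_succ _ _
  have hnew : μ[fun ω => P.real S - S.indicator (fun _ => (1 : ℝ)) (Z (i + 1) ω) | 𝒢 i] =ᵐ[μ]
      fun _ => (0 : ℝ) := by
    have := condExp_indep_eq (hZ (i + 1)).comap_le (𝒢.le i)
      (stronglyMeasurable_deficitTerm (P := P) (comap_measurable (Z (i + 1))) hS)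
      (hindep.indep_comap_natural_of_lt (fun n => (hZ n).stronglyMeasurable) (Nat.lt_succ_self i))
    rwa [integral_deficitTerm (hZ (i + 1)) (hlaw _) hS] at this
  rw [hsucc]
  have hadd := condExp_add (hint i) (integrable_deficitTerm (P := P) (hZ (i + 1)) hS) (𝒢 i)
  rw [condExp_of_stronglyMeasurable (𝒢.le i) (hadp i) (hint i)] at hadd
  filter_upwards [hadd, hnew] with ω h1 h2
  rw [h1, Pi.add_apply, h2, add_zero]

theorem submartingale_excessDeficit [Fintype ι] [Nonempty ι] (hZ : ∀ n, Measurable (Z n))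
    (hlaw : ∀ n, μ.map (Z n) = P) (hindep : iIndepFun Z μ) (hm : ∀ k, MeasurableSet (A k))
    (a : ℝ) :
    Submartingale (excessDeficit P Z A a)
      (Filtration.natural Z fun n => (hZ n).stronglyMeasurable) μ := by
  refine Submartingale.pos (Submartingale.sub_martingale ?_ (martingale_const _ _ a))
  exact Finset.sup'_induction (p := fun f => Submartingale f _ μ) _ _ (fun _ h₁ _ h₂ => Submartingale.sup h₁ h₂)
    fun k _ => (martingale_visitDeficit hZ hlaw hindep (hm k)).submartingale

variable [IsProbabilityMeasure P]

/-- The tail of the largest visit deficit along a finite chain. -/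
theorem measureReal_lt_maxDeficit_le [Fintype ι] [Nonempty ι] [LinearOrder ι]
    (hZ : ∀ n, Measurable (Z n)) (hlaw : ∀ n, μ.map (Z n) = P) (hindep : iIndepFun Z μ)
    (hA : Monotone A) (hm : ∀ k, MeasurableSet (A k)) (hp : ∀ k, P.real (A k) < 1) (i : ℕ)
    {u : ℝ} (hu : 0 < u) :
    μ.real {ω | u < maxDeficit P Z A i ω} ≤
      Real.exp (-(1.76 * u ^ 2 / ((i + 1 : ℕ) : ℝ))) := by
  set n : ℕ := i + 1 with hn
  have hn0 : (0 : ℝ) < n := by positivity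
  have hcount : ∀ (y : Fin n → Prop), 0 ≤ countTrue y := fun y =>
    Finset.sum_nonneg fun j _ => by split_ifs <;> norm_num
  have hsub : {ω | u < maxDeficit P Z A i ω} ⊆ (fun ω (j : Fin n) => Z j ω) ⁻¹'
      {x | ∃ k, countTrue (fun j => x j ∈ A k) ≤ n * (P.real (A k) - u / n)} := by
    intro ω hω
    obtain ⟨k, hk⟩ := lt_maxDeficit_iff.1 hω
    rw [visitDeficit_eq] at hk
    refine ⟨k, ?_⟩
    rw [mul_sub, mul_div_cancel₀ _ hn0.ne']
    linarith
  rcases lt_or_ge (u / n) 1 with hlt | hge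
  · have hmap : μ.map (fun ω (j : Fin n) => Z j ω) = Measure.pi fun _ : Fin n => P := by
      have h := hindep.precomp (g := fun j : Fin n => (j : ℕ)) Fin.val_injective
      rw [iIndepFun_iff_map_fun_eq_pi_map fun j => (hZ _).aemeasurable] at h
      simpa [hlaw] using h
    have hb := pi_exists_frequency_le hA hm hp n (div_pos hu hn0) hlt
    rw [← hmap] at hb
    have hle := (measure_mono hsub).trans ((Measure.le_map_apply
      (measurable_pi_lambda _ fun j : Fin n => hZ j).aemeasurable _).trans hb)
    have he : 1.76 * (n : ℝ) * (u / n) ^ 2 = 1.76 * u ^ 2 / n := by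
      field_simp
    rw [he] at hle
    exact ENNReal.toReal_le_of_le_ofReal (Real.exp_nonneg _) hle
  -- The tilt needs ε < 1; otherwise u ≥ n, while a deficit is at most n P(A k) < n.
  · have : {ω | u < maxDeficit P Z A i ω} = ∅ := by
      refine Set.eq_empty_of_forall_notMem fun ω hω => ?_
      obtain ⟨k, hk⟩ := hsub hω
      have h1 := hcount fun j : Fin n => Z j ω ∈ A k
      have h2 : (n : ℝ) * (P.real (A k) - u / n) < 0 :=
        mul_neg_of_pos_of_neg hn0 (by linarith [hp k])
      linarith
    rw [this, measureReal_empty]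
    exact Real.exp_nonneg _

/-- Integrating the Gaussian tail after (a + t)² ≥ a² + 2at turns it into an exponential one, of
rate 3.52 a/n. -/
theorem integral_excessDeficit_le [Fintype ι] [Nonempty ι] [LinearOrder ι]
    (hZ : ∀ n, Measurable (Z n)) (hlaw : ∀ n, μ.map (Z n) = P) (hindep : iIndepFun Z μ)
    (hA : Monotone A) (hm : ∀ k, MeasurableSet (A k)) (hp : ∀ k, P.real (A k) < 1) (i : ℕ)
    {a : ℝ} (ha : 0 < a) :
    ∫ ω, excessDeficit P Z A a i ω ∂μ ≤
      Real.exp (-(1.76 * a ^ 2 / ((i + 1 : ℕ) : ℝ))) * (((i + 1 : ℕ) : ℝ) / (3.52 * a)) := by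
  set n : ℝ := ((i + 1 : ℕ) : ℝ) with hn
  have hn0 : 0 < n := by positivity
  have hsubm := submartingale_excessDeficit hZ hlaw hindep hm a
  have happ : ∀ ω, excessDeficit P Z A a i ω =
      max (maxDeficit P Z A i ω - a) 0 := fun ω => rfl
  rw [(hsubm.integrable i).integral_eq_integral_meas_lt
    (Filter.Eventually.of_forall fun ω => by
      simp only [happ, Pi.zero_apply]; exact le_max_right _ _)]
  have hneg : -(3.52 * a / n) < 0 := by
    rw [neg_lt_zero]; positivity
  have hle : ∀ t ∈ Set.Ioi (0 : ℝ),
      μ.real {ω | t < excessDeficit P Z A a i ω} ≤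
        Real.exp (-(1.76 * a ^ 2 / n)) * Real.exp (-(3.52 * a / n) * t) := by
    intro t ht
    have ht' : 0 < t := ht
    have heq : {ω | t < excessDeficit P Z A a i ω} =
        {ω | a + t < maxDeficit P Z A i ω} := by
      ext ω
      simp only [happ, Set.mem_ofPred_eq, lt_max_iff, not_lt.2 ht'.le, or_false]
      exact lt_sub_iff_add_lt'
    rw [heq, ← Real.exp_add]
    refine (measureReal_lt_maxDeficit_le hZ hlaw hindep hA hm hp i (by positivity)).trans
      (Real.exp_le_exp.2 ?_)
    rw [← hn]
    have e : -(1.76 * a ^ 2 / n) + -(3.52 * a / n) * t = -(1.76 * (a + t) ^ 2 / n)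
        + 1.76 * t ^ 2 / n := by
      field_simp
      ring
    have : 0 ≤ 1.76 * t ^ 2 / n := by positivity
    linarith
  calc
    _ ≤ ∫ t in Set.Ioi (0 : ℝ), Real.exp (-(1.76 * a ^ 2 / n)) * Real.exp (-(3.52 * a / n) * t) :=
        integral_mono_of_nonneg (Filter.Eventually.of_forall fun t => measureReal_nonneg)
          ((integrableOn_exp_mul_Ioi hneg 0).const_mul _)
          ((ae_restrict_iff' measurableSet_Ioi).2 (Filter.Eventually.of_forall hle))
    _ = _ := by
        rw [integral_const_mul, integral_exp_mul_Ioi hneg]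
        simp

/-- A maximal inequality for the visit deficits along a finite chain. -/
theorem measureReal_exists_le_visitDeficit_le [Fintype ι] [LinearOrder ι]
    (hZ : ∀ n, Measurable (Z n)) (hlaw : ∀ n, μ.map (Z n) = P) (hindep : iIndepFun Z μ)
    (hA : Monotone A) (hm : ∀ k, MeasurableSet (A k)) (hp : ∀ k, P.real (A k) < 1) (m : ℕ)
    {y : ℝ} (hy : 0 < y) (hym : 4.12 * ((m + 1 : ℕ) : ℝ) ≤ y ^ 2) :
    μ.real {ω | ∃ i ≤ m, ∃ k, y ≤ visitDeficit P Z (A k) i ω} ≤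
      3 * Real.exp (-(1.76 * y ^ 2 / ((m + 1 : ℕ) : ℝ))) := by
  rcases isEmpty_or_nonempty ι with hι | hι
  · simp only [IsEmpty.exists_iff, and_false, exists_false]
    rw [show {ω : Ω | False} = ∅ from rfl, measureReal_empty]
    positivity
  set n : ℝ := ((m + 1 : ℕ) : ℝ) with hn
  have hn0 : 0 < n := by positivity
  -- Doob's inequality is applied at distance b = y - a. This b makes the exponent at a differ from
  -- that at y by at most 1, so the total loss is e · y/a ≤ 1.08 e < 3. The factor 14.5 below comes
  -- from 14.5/3.52 < 4.12.
  set b : ℝ := n / (3.52 * y) with hb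
  have hb0 : 0 < b := by positivity
  have hby : b * 14.5 ≤ y := by
    rw [hb, div_mul_eq_mul_div, div_le_iff₀ (by positivity)]
    nlinarith
  set a : ℝ := y - b with hadef
  have ha0 : 0 < a := by linarith
  have hsubm := submartingale_excessDeficit hZ hlaw hindep hm a
  have hnonneg : (0 : ℕ → Ω → ℝ) ≤ excessDeficit P Z A a := posPart_nonneg _
  have hdoob := maximal_ineq hsubm hnonneg (ε := b.toNNReal) m
  set E : Set Ω := {ω | (b.toNNReal : ℝ) ≤ (Finset.range (m + 1)).sup' Finset.nonempty_range_add_one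
    fun k => excessDeficit P Z A a k ω} with hE
  have hsub : {ω | ∃ i ≤ m, ∃ k, y ≤ visitDeficit P Z (A k) i ω} ⊆ E := by
    rintro ω ⟨i, hi, hk⟩
    have h1 := le_maxDeficit_iff.2 hk
    rw [hE, Set.mem_ofPred_eq, Finset.le_sup'_iff]
    refine ⟨i, Finset.mem_range.2 (Nat.lt_succ_iff.2 hi), ?_⟩
    rw [Real.coe_toNNReal _ hb0.le]
    refine le_trans ?_ (le_max_left (maxDeficit P Z A i ω - a) 0)
    linarith
  have hEI : ∫ ω in E, excessDeficit P Z A a m ω ∂μ ≤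
      Real.exp (-(1.76 * a ^ 2 / n)) * (n / (3.52 * a)) :=
    (setIntegral_le_integral (hsubm.integrable m)
      (Filter.Eventually.of_forall fun ω => hnonneg m ω)).trans
      (integral_excessDeficit_le hZ hlaw hindep hA hm hp m ha0)
  have hbE : b * μ.real E ≤ Real.exp (-(1.76 * a ^ 2 / n)) * (n / (3.52 * a)) := by
    have := ENNReal.toReal_le_of_le_ofReal (by positivity)
      (hdoob.trans (ENNReal.ofReal_le_ofReal hEI))
    rwa [ENNReal.toReal_mul, ENNReal.coe_toReal, Real.coe_toNNReal _ hb0.le] at this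
  have hratio : n / (3.52 * a) = b * (y / a) := by
    rw [hb]
    field_simp
  have h1 : μ.real E ≤ Real.exp (-(1.76 * a ^ 2 / n)) * (y / a) := by
    rw [hratio, mul_left_comm] at hbE
    exact le_of_mul_le_mul_left hbE hb0
  have hya : y / a ≤ 1.08 := by
    rw [div_le_iff₀ ha0]
    linarith
  have hexp : Real.exp (-(1.76 * a ^ 2 / n)) ≤ Real.exp 1 * Real.exp (-(1.76 * y ^ 2 / n)) := by
    rw [← Real.exp_add]
    refine Real.exp_le_exp.2 ?_
    have e : 1.76 * y ^ 2 / n - 1.76 * a ^ 2 / n = 1 - 1.76 * b ^ 2 / n := by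
      have : n = 3.52 * y * b := by rw [hb]; field_simp
      rw [hadef, this]
      field_simp
      ring
    have : 0 ≤ 1.76 * b ^ 2 / n := by positivity
    linarith
  have he := Real.exp_one_lt_d9
  calc _ ≤ μ.real E := measureReal_mono hsub
    _ ≤ (Real.exp 1 * Real.exp (-(1.76 * y ^ 2 / n))) * 1.08 :=
        h1.trans (mul_le_mul hexp hya (by positivity) (by positivity))
    _ = (Real.exp 1 * 1.08) * Real.exp (-(1.76 * y ^ 2 / n)) := by ring
    _ ≤ 3 * Real.exp (-(1.76 * y ^ 2 / n)) :=
        mul_le_mul_of_nonneg_right (by linarith) (Real.exp_nonneg _)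

end Deficit

/-! ### Geometric epochs and the choice of constants. -/

section Epochs

/-- The ratio of the lengths of consecutive epochs. -/
noncomputable def epochRatio : ℝ := 1.017

/-- The smallest value of `i * howardRamdasRadius δ i` in the `k`-th epoch. -/
noncomputable def epochLevel (δ : ℝ) (k : ℕ) : ℝ :=
  0.85 * Real.sqrt (epochRatio ^ k *
    (Real.log (1 + k * Real.log epochRatio) + 0.8 * Real.log (1612 / δ)))

theorem log_epochRatio_ge : 0.0168 ≤ Real.log epochRatio := by
  have := Real.le_log_one_add_of_nonneg (x := 0.017) (by norm_num)
  rw [show (1 : ℝ) + 0.017 = epochRatio by norm_num [epochRatio]] at this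
  refine le_trans ?_ this
  norm_num

theorem log_1612_ge : 7.25 ≤ Real.log 1612 := by
  rw [Real.le_log_iff_exp_le (by norm_num)]
  refine (pow_le_pow_iff_left₀ (Real.exp_nonneg _) (by norm_num) (n := 4) (by norm_num)).1 ?_
  rw [← Real.exp_nat_mul, show ((4 : ℕ) : ℝ) * 7.25 = (29 : ℕ) * 1 by norm_num, Real.exp_nat_mul]
  exact (pow_le_pow_left₀ (Real.exp_nonneg _) Real.exp_one_lt_d9.le 29).trans (by norm_num)

variable {δ : ℝ}

theorem log_ratio_ge (hδ : δ ∈ Set.Ioo (0 : ℝ) 1) : 5.8 ≤ 0.8 * Real.log (1612 / δ) := by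
  have h1 : Real.log 1612 ≤ Real.log (1612 / δ) := by
    refine Real.log_le_log (by norm_num) ?_
    rw [le_div_iff₀ hδ.1]
    linarith [hδ.2]
  linarith [log_1612_ge]

theorem epochLevel_le (hδ : δ ∈ Set.Ioo (0 : ℝ) 1) {i k : ℕ} (hi : 1 ≤ i)
    (hk : epochRatio ^ k ≤ i) : epochLevel δ k ≤ i * howardRamdasRadius δ i := by
  have hi0 : (0 : ℝ) < i := by exact_mod_cast hi
  have hη : 0 < epochRatio := by norm_num [epochRatio]
  have hl := log_epochRatio_ge
  have hC := log_ratio_ge hδ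
  have hk0 : (0 : ℝ) ≤ k := Nat.cast_nonneg k
  have hlog : k * Real.log epochRatio ≤ Real.log i := by
    rw [← Real.log_pow]
    exact Real.log_le_log (by positivity) hk
  have h1 : Real.log (1 + k * Real.log epochRatio) ≤ Real.log (Real.log (Real.exp 1 * i)) := by
    rw [Real.log_mul (Real.exp_ne_zero _) hi0.ne', Real.log_exp]
    exact Real.log_le_log (by positivity) (by linarith)
  have h0 : 0 ≤ Real.log (1 + k * Real.log epochRatio) :=
    Real.log_nonneg (by linarith [mul_nonneg hk0 (hl.trans' (by norm_num))])
  rw [howardRamdasRadius, epochLevel, mul_left_comm]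
  refine mul_le_mul_of_nonneg_left ?_ (by norm_num)
  have e : ∀ L : ℝ, (i : ℝ) * Real.sqrt (1 / (i : ℝ) * L) = Real.sqrt (i * L) := by
    intro L
    have h : (i : ℝ) * L = (i : ℝ) ^ 2 * (1 / (i : ℝ) * L) := by field_simp
    rw [h, Real.sqrt_mul (sq_nonneg (i : ℝ)), Real.sqrt_sq hi0.le]
  rw [e]
  refine Real.sqrt_le_sqrt ?_
  exact mul_le_mul hk (by linarith) (by linarith) hi0.le

theorem sq_epochLevel (hδ : δ ∈ Set.Ioo (0 : ℝ) 1) (k : ℕ) :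
    epochLevel δ k ^ 2 = 0.7225 * (epochRatio ^ k *
      (Real.log (1 + k * Real.log epochRatio) + 0.8 * Real.log (1612 / δ))) := by
  have hη : 0 < epochRatio := by norm_num [epochRatio]
  have hl := log_epochRatio_ge
  have hC := log_ratio_ge hδ
  have h0 : 0 ≤ Real.log (1 + k * Real.log epochRatio) :=
    Real.log_nonneg (by
      linarith [mul_nonneg (Nat.cast_nonneg (α := ℝ) k) (hl.trans' (by norm_num))])
  rw [epochLevel, mul_pow, Real.sq_sqrt (by positivity)]
  norm_num

/-- The right-endpoint rectangle under the decreasing function s ↦ s^(-5/4) is at most its integral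
over [u, v]. The proof scales to u/v and uses Bernoulli's inequality. -/
theorem rpow_neg_le_telescope {u v : ℝ} (hu : 0 < u) (huv : u ≤ v) :
    (v - u) * v ^ (-(5 / 4) : ℝ) ≤ 4 * (u ^ (-(1 / 4) : ℝ) - v ^ (-(1 / 4) : ℝ)) := by
  have hv : 0 < v := hu.trans_le huv
  have ht0 : 0 < u / v := div_pos hu hv
  have ht1 : u / v ≤ 1 := (div_le_one hv).2 huv
  have h1 : (u / v) ^ (1 / 4 : ℝ) ≤ 1 + 1 / 4 * (u / v - 1) := by
    have := rpow_one_add_le_one_add_mul_self (s := u / v - 1) (by linarith)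
      (p := 1 / 4) (by norm_num) (by norm_num)
    rwa [add_sub_cancel] at this
  have h2 : 1 + (1 - u / v) / 4 ≤ (u / v) ^ (-(1 / 4) : ℝ) := by
    rw [Real.rpow_neg ht0.le, le_inv_comm₀ (by linarith) (Real.rpow_pos_of_pos ht0 _)]
    refine h1.trans ?_
    rw [le_inv_comm₀ (by linarith) (by linarith), inv_eq_one_div, le_div_iff₀ (by linarith)]
    nlinarith [sq_nonneg (1 - u / v)]
  have e1 : u ^ (-(1 / 4) : ℝ) = v ^ (-(1 / 4) : ℝ) * (u / v) ^ (-(1 / 4) : ℝ) := by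
    rw [← Real.mul_rpow hv.le ht0.le, mul_div_cancel₀ _ hv.ne']
  have e2 : v ^ (-(1 / 4) : ℝ) = v * v ^ (-(5 / 4) : ℝ) := by
    nth_rewrite 2 [← Real.rpow_one v]
    rw [← Real.rpow_add hv]
    norm_num
  have e3 : (v - u) * v ^ (-(5 / 4) : ℝ) = v ^ (-(1 / 4) : ℝ) * (1 - u / v) := by
    rw [e2]
    field_simp
  rw [e1, e3]
  nlinarith [Real.rpow_pos_of_pos hv (-(1 / 4))]

theorem sum_rpow_neg_le {c : ℝ} (hc : 0 < c) (K : ℕ) :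
    ∑ k ∈ Finset.range K, (1 + k * c) ^ (-(5 / 4) : ℝ) ≤ 1 + 4 / c := by
  have key : ∀ K : ℕ, ∑ k ∈ Finset.range (K + 1), (1 + k * c) ^ (-(5 / 4) : ℝ) ≤
      1 + 4 / c * (1 - (1 + K * c) ^ (-(1 / 4) : ℝ)) := by
    intro K
    induction K with
    | zero => simp
    | succ K ih =>
      rw [Finset.sum_range_succ]
      have h := rpow_neg_le_telescope (u := 1 + K * c) (v := 1 + (K + 1 : ℕ) * c) (by positivity)
        (by push_cast; nlinarith)
      have e : (1 + ((K + 1 : ℕ) : ℝ) * c) - (1 + K * c) = c := by push_cast; ring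
      rw [e, ← le_div_iff₀' hc] at h
      calc _ ≤ 1 + 4 / c * (1 - (1 + K * c) ^ (-(1 / 4) : ℝ)) + _ := add_le_add ih h
        _ = _ := by ring
  cases K with
  | zero =>
    simp only [Finset.range_zero, Finset.sum_empty]
    positivity
  | succ K =>
    refine (key K).trans ?_
    have : 0 ≤ 4 / c * (1 + K * c) ^ (-(1 / 4) : ℝ) := by positivity
    linarith

variable {Ω : Type*} [MeasurableSpace Ω] {μ : Measure Ω} [IsProbabilityMeasure μ]
  {P : Measure ℝ} [IsProbabilityMeasure P] {Z : ℕ → Ω → ℝ} {ι : Type*} [Fintype ι] [LinearOrder ι]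
  {A : ι → Set ℝ}

/-- The maximal inequality at the last sample size of the epoch. An exponent of 5/4 times the
bracket in g_i suffices: it gives the summable power -5/4 on the iterated logarithm, and 5/4 · 0.8 =
1 gives δ/1612. -/
theorem measureReal_epoch_le (hδ : δ ∈ Set.Ioo (0 : ℝ) 1)
    (hZ : ∀ n, Measurable (Z n)) (hlaw : ∀ n, μ.map (Z n) = P) (hindep : iIndepFun Z μ)
    (hA : Monotone A) (hm : ∀ k, MeasurableSet (A k)) (hp : ∀ k, P.real (A k) < 1) (k : ℕ) :
    μ.real {ω | ∃ i : ℕ, ((i + 1 : ℕ) : ℝ) < epochRatio ^ (k + 1) ∧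
        ∃ l, epochLevel δ k ≤ visitDeficit P Z (A l) i ω} ≤
      3 * (δ / 1612) * (1 + k * Real.log epochRatio) ^ (-(5 / 4) : ℝ) := by
  have hη : 1 < epochRatio := by norm_num [epochRatio]
  have hη0 : 0 < epochRatio := one_pos.trans hη
  have hl := log_epochRatio_ge
  have hC := log_ratio_ge hδ
  have hk0 : 0 ≤ k * Real.log epochRatio :=
    mul_nonneg (Nat.cast_nonneg (α := ℝ) k) (hl.trans' (by norm_num))
  have h0 : 0 ≤ Real.log (1 + k * Real.log epochRatio) := Real.log_nonneg (by linarith)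
  set L := Real.log (1 + k * Real.log epochRatio) + 0.8 * Real.log (1612 / δ) with hL
  have hL0 : 5.8 ≤ L := by linarith
  have hpow : 0 < epochRatio ^ k := by positivity
  obtain ⟨m, hm'⟩ : ∃ m, ⌊epochRatio ^ (k + 1)⌋₊ = m + 1 :=
    Nat.exists_eq_succ_of_ne_zero
      (Nat.pos_iff_ne_zero.1 (Nat.floor_pos.2 (one_le_pow₀ hη.le)))
  have hmle : ((m + 1 : ℕ) : ℝ) ≤ epochRatio ^ k * 1.017 := by
    rw [← hm']
    exact (Nat.floor_le (by positivity)).trans_eq (by rw [pow_succ]; rfl)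
  have hm0 : (0 : ℝ) < ((m + 1 : ℕ) : ℝ) := by positivity
  have hsq := sq_epochLevel hδ k
  rw [← hL] at hsq
  have hy : 0 < epochLevel δ k := by
    unfold epochLevel
    rw [← hL]
    positivity
  -- Numerically 0.85² · 5.8 = 4.1905 against 4.12 · 1.017 = 4.19004.
  have hym : 4.12 * ((m + 1 : ℕ) : ℝ) ≤ epochLevel δ k ^ 2 := by
    rw [hsq]
    nlinarith [mul_le_mul_of_nonneg_left hL0 hpow.le]
  have hmax := measureReal_exists_le_visitDeficit_le hZ hlaw hindep hA hm hp m hy hym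
  have hsub : {ω | ∃ i : ℕ, ((i + 1 : ℕ) : ℝ) < epochRatio ^ (k + 1) ∧
        ∃ l, epochLevel δ k ≤ visitDeficit P Z (A l) i ω} ⊆
      {ω | ∃ i ≤ m, ∃ l, epochLevel δ k ≤ visitDeficit P Z (A l) i ω} := by
    rintro ω ⟨i, hi, hω⟩
    refine ⟨i, ?_, hω⟩
    have := Nat.le_floor hi.le
    omega
  have hexp : Real.exp (-(1.76 * epochLevel δ k ^ 2 / ((m + 1 : ℕ) : ℝ))) ≤
      (δ / 1612) * (1 + k * Real.log epochRatio) ^ (-(5 / 4) : ℝ) := by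
    -- Numerically 1.76 · 0.85² = 1.2716 against 1.25 · 1.017 = 1.27125; this is what the epoch
    -- ratio has to satisfy.
    have hle : 5 / 4 * L ≤ 1.76 * epochLevel δ k ^ 2 / ((m + 1 : ℕ) : ℝ) := by
      rw [le_div_iff₀ hm0, hsq]
      nlinarith [mul_le_mul_of_nonneg_left hmle (by linarith : 0 ≤ 5 / 4 * L),
        mul_pos hpow (by linarith : 0 < L)]
    have hδ' : δ / 1612 = Real.exp (-Real.log (1612 / δ)) := by
      rw [← Real.log_inv, inv_div, Real.exp_log (div_pos hδ.1 (by norm_num))]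
    rw [hδ', Real.rpow_def_of_pos (by linarith), ← Real.exp_add]
    refine Real.exp_le_exp.2 ?_
    rw [hL] at hle
    linarith
  calc _ ≤ _ := measureReal_mono hsub
    _ ≤ _ := hmax
    _ ≤ 3 * ((δ / 1612) * (1 + k * Real.log epochRatio) ^ (-(5 / 4) : ℝ)) := by gcongr
    _ = _ := by ring

/-- A time-uniform deviation bound, up to a finite horizon, for the frequencies of the sets of a
finite chain. -/
theorem measureReal_exists_radius_lt_le (hδ : δ ∈ Set.Ioo (0 : ℝ) 1)
    (hZ : ∀ n, Measurable (Z n)) (hlaw : ∀ n, μ.map (Z n) = P) (hindep : iIndepFun Z μ)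
    (hA : Monotone A) (hm : ∀ k, MeasurableSet (A k)) (hp : ∀ k, P.real (A k) < 1) (T : ℕ) :
    μ.real {ω | ∃ i ≤ T, ∃ l, ((i + 1 : ℕ) : ℝ) * howardRamdasRadius δ (i + 1) <
        visitDeficit P Z (A l) i ω} ≤ δ / 2 := by
  have hη : 1 < epochRatio := by norm_num [epochRatio]
  obtain ⟨K, hK⟩ := pow_unbounded_of_one_lt ((T + 1 : ℕ) : ℝ) hη
  have hsub : {ω | ∃ i ≤ T, ∃ l, ((i + 1 : ℕ) : ℝ) * howardRamdasRadius δ (i + 1) <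
        visitDeficit P Z (A l) i ω} ⊆
      ⋃ k ∈ Finset.range K, {ω | ∃ i : ℕ, ((i + 1 : ℕ) : ℝ) < epochRatio ^ (k + 1) ∧
        ∃ l, epochLevel δ k ≤ visitDeficit P Z (A l) i ω} := by
    rintro ω ⟨i, hiT, l, hl⟩
    obtain ⟨k, hk1, hk2⟩ := exists_nat_pow_near (x := ((i + 1 : ℕ) : ℝ))
      (by exact_mod_cast Nat.succ_pos i) hη
    have hkK : k < K := by
      refine (pow_lt_pow_iff_right₀ hη).1 ((hk1.trans ?_).trans_lt hK)
      exact_mod_cast Nat.succ_le_succ hiT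
    exact Set.mem_biUnion (Finset.mem_range.2 hkK)
      ⟨i, hk2, l, (epochLevel_le hδ (Nat.succ_pos i) hk1).trans hl.le⟩
  have hl := log_epochRatio_ge
  have hl0 : 0 < Real.log epochRatio := hl.trans_lt' (by norm_num)
  have hsum := sum_rpow_neg_le hl0 K
  have h4 : 4 / Real.log epochRatio ≤ 239 := by
    rw [div_le_iff₀ hl0]
    linarith
  calc _ ≤ _ := measureReal_mono hsub (measure_ne_top _ _)
    _ ≤ _ := measureReal_biUnion_finset_le _ _
    _ ≤ ∑ k ∈ Finset.range K, 3 * (δ / 1612) * (1 + k * Real.log epochRatio) ^ (-(5 / 4) : ℝ) :=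
        Finset.sum_le_sum fun k _ => measureReal_epoch_le hδ hZ hlaw hindep hA hm hp k
    _ = 3 * (δ / 1612) * ∑ k ∈ Finset.range K, (1 + k * Real.log epochRatio) ^ (-(5 / 4) : ℝ) := by
        rw [Finset.mul_sum]
    -- The series is at most 1 + 239, and 3 · 240/1612 < 1/2. The bound does not depend on the
    -- horizon `T`.
    _ ≤ 3 * (δ / 1612) * 240 := by
        have := hδ.1
        exact mul_le_mul_of_nonneg_left (by linarith) (by positivity)
    _ ≤ δ / 2 := by linarith [hδ.1]

end Epochs

/-! ### Empirical distribution functions and their quantiles. -/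

section EmpiricalCDF

variable {n : ℕ} {x : Fin n → ℝ}

theorem empiricalCDF_mono (x : Fin n → ℝ) : Monotone (empiricalCDF x) := by
  intro s t hst
  unfold empiricalCDF
  refine mul_le_mul_of_nonneg_left (Finset.sum_le_sum fun j _ => ?_) (by positivity)
  exact Set.indicator_le_indicator_of_subset (Set.Iic_subset_Iic.2 hst) (fun _ => zero_le_one) _

open Filter Topology in
theorem eventually_empiricalCDF_eq (x : Fin n → ℝ) (t : ℝ) :
    ∀ᶠ s in 𝓝[>] t, empiricalCDF x s = empiricalCDF x t := by
  have h : ∀ j, ∀ᶠ s in 𝓝[>] t, (x j ≤ s ↔ x j ≤ t) := by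
    intro j
    rcases le_or_gt (x j) t with hj | hj
    · filter_upwards [self_mem_nhdsWithin] with s hs
      exact ⟨fun _ => hj, fun h => h.trans (le_of_lt hs)⟩
    · filter_upwards [mem_nhdsWithin_of_mem_nhds (Iio_mem_nhds hj)] with s hs
      exact ⟨fun h => absurd h (not_le.2 hs), fun h => absurd h (not_le.2 hj)⟩
  filter_upwards [eventually_all.2 h] with s hs
  unfold empiricalCDF
  congr 1
  refine Finset.sum_congr rfl fun j _ => ?_
  simp only [Set.indicator_apply, Set.mem_Iic, hs j]

theorem exists_empiricalCDF_eq_zero (x : Fin n → ℝ) : ∃ t, empiricalCDF x t = 0 := by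
  obtain ⟨b, hb⟩ := (Set.finite_range x).bddBelow
  refine ⟨b - 1, ?_⟩
  unfold empiricalCDF
  rw [Finset.sum_eq_zero, mul_zero]
  intro j _
  have : b ≤ x j := hb ⟨j, rfl⟩
  rw [Set.indicator_of_notMem]
  simp only [Set.mem_Iic, not_le]
  linarith

theorem exists_le_empiricalCDF_of_lowerQuantile_lt_top (x : Fin n → ℝ) {p : ℝ} (hp : 0 < p)
    (h : empLowerQuantile x p < ⊤) :
    ∃ q : ℝ, empLowerQuantile x p = q ∧ p ≤ empiricalCDF x q := by
  obtain ⟨t, ht⟩ := exists_empiricalCDF_eq_zero x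
  have hbot : empLowerQuantile x p ≠ ⊥ := by
    refine ne_of_gt ((EReal.bot_lt_coe t).trans_le (le_sSup ⟨t, ?_, rfl⟩))
    rw [Set.mem_ofPred_eq, ht]
    exact hp
  refine ⟨(empLowerQuantile x p).toReal, (EReal.coe_toReal h.ne hbot).symm, ?_⟩
  set q := (empLowerQuantile x p).toReal
  -- Right continuity in its step-function form: some s > q has the same empirical value, and a
  -- value below p would put s in the set whose supremum is q.
  obtain ⟨s, hs, hqs⟩ := ((eventually_empiricalCDF_eq x q).and self_mem_nhdsWithin).exists
  rw [← hs]
  by_contra hlt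
  have hle : (s : EReal) ≤ empLowerQuantile x p := le_sSup ⟨s, not_le.1 hlt, rfl⟩
  rw [← EReal.coe_toReal h.ne hbot, EReal.coe_le_coe_iff] at hle
  exact absurd hle (not_le.2 hqs)

theorem upperQuantile_le_lowerQuantile (F : ℝ → ℝ) {p q : ℝ} (h : p < q) :
    upperQuantile F p ≤ lowerQuantile F q :=
  sSup_le_sSup (Set.image_mono fun _ ht => lt_of_le_of_lt ht h)

theorem lowerQuantile_le_upperQuantile (F : ℝ → ℝ) (p : ℝ) :
    lowerQuantile F p ≤ upperQuantile F p :=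
  sSup_le_sSup (Set.image_mono fun t ht => show F t ≤ p from le_of_lt ht)

theorem empiricalCDF_le_of_lt_upperQuantile {z p : ℝ} (h : (z : EReal) < empUpperQuantile x p) :
    empiricalCDF x z ≤ p := by
  obtain ⟨_, ⟨t, ht, rfl⟩, hzt⟩ := lt_sSup_iff.1 h
  exact (empiricalCDF_mono x (EReal.coe_lt_coe_iff.1 hzt).le).trans ht

end EmpiricalCDF

/-! ### Deterministic coverage bounds on the good event. -/

section Coverage

variable {P : Measure ℝ} [IsProbabilityMeasure P] {n : ℕ} {x : Fin n → ℝ} {g : ℝ}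

theorem measureReal_Ioi_eq (P : Measure ℝ) [IsProbabilityMeasure P] (t : ℝ) :
    P.real (Set.Ioi t) = 1 - P.real (Set.Iic t) := by
  rw [← Set.compl_Iic, probReal_compl_eq_one_sub measurableSet_Iic]

/-- Continuity from below along rational half-lines; the end point is excluded, so a possible atom
there does not count. -/
theorem measureReal_coe_lt_le {u : EReal} {b : ℝ} (hb : 0 ≤ b)
    (h : ∀ z : ℝ, (z : EReal) < u → P.real (Set.Iic z) ≤ b) :
    P.real {z : ℝ | (z : EReal) < u} ≤ b := by
  have hsub : {z : ℝ | (z : EReal) < u} ⊆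
      ⋃ r : {r : ℚ // ((r : ℝ) : EReal) < u}, Set.Iic ((r : ℚ) : ℝ) := by
    intro z hz
    obtain ⟨y, hzy, hyu⟩ := EReal.lt_iff_exists_rat_btwn.1 hz
    exact Set.mem_iUnion.2 ⟨⟨y, hyu⟩, (EReal.coe_lt_coe_iff.1 hzy).le⟩
  refine ENNReal.toReal_le_of_le_ofReal hb ((measure_mono hsub).trans ?_)
  have hdir : Directed (· ⊆ ·)
      fun r : {r : ℚ // ((r : ℝ) : EReal) < u} => Set.Iic ((r : ℚ) : ℝ) :=
    Monotone.directed_le fun r s hrs => Set.Iic_subset_Iic.2 (Rat.cast_le.2 hrs)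
  rw [hdir.measure_iUnion]
  refine iSup_le fun r => ?_
  rw [← ofReal_measureReal]
  exact ENNReal.ofReal_le_ofReal (h _ r.2)

theorem measureReal_coe_lt_upperQuantile_le
    (H : ∀ t, |P.real (Set.Iic t) - empiricalCDF x t| ≤ g) {p : ℝ} (hp : 0 ≤ p + g) :
    P.real {z : ℝ | (z : EReal) < empUpperQuantile x p} ≤ p + g := by
  refine measureReal_coe_lt_le hp fun z hz => ?_
  have h1 := empiricalCDF_le_of_lt_upperQuantile hz
  have h2 := (abs_le.1 (H z)).2
  linarith

theorem measureReal_lowerQuantile_lt_coe_le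
    (H : ∀ t, |P.real (Set.Iic t) - empiricalCDF x t| ≤ g) {p : ℝ} (hp : 0 < p)
    (hpg : p - g ≤ 1) :
    P.real {z : ℝ | empLowerQuantile x p < (z : EReal)} ≤ 1 - (p - g) := by
  rcases eq_or_ne (empLowerQuantile x p) ⊤ with h | h
  · rw [h]
    simp only [not_top_lt]
    rw [show {z : ℝ | False} = ∅ from rfl, measureReal_empty]
    linarith
  · obtain ⟨q, hq, hpq⟩ := exists_le_empiricalCDF_of_lowerQuantile_lt_top x hp h.lt_top
    have hset : {z : ℝ | empLowerQuantile x p < (z : EReal)} = Set.Ioi q := by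
      ext z
      rw [hq]
      exact EReal.coe_lt_coe_iff
    rw [hset, measureReal_Ioi_eq]
    linarith [(abs_le.1 (H q)).1]

theorem measurableSet_predictionInterval (δ : ℝ) (x : Fin n → ℝ) (α : ℝ) :
    MeasurableSet (predictionInterval δ x α) :=
  (measurableSet_le measurable_const measurable_coe_real_ereal).inter
    (measurableSet_le measurable_coe_real_ereal measurable_const)

theorem compl_predictionInterval (δ : ℝ) (x : Fin n → ℝ) (α : ℝ) :
    (predictionInterval δ x α)ᶜ =
      {z : ℝ | (z : EReal) < empUpperQuantile x (α / 2 - howardRamdasRadius δ n)} ∪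
        {z : ℝ | empLowerQuantile x (1 - α / 2 + howardRamdasRadius δ n) < (z : EReal)} := by
  ext z
  simp only [predictionInterval, Set.mem_compl_iff, Set.mem_ofPred_eq, not_and_or, not_le,
    Set.mem_union]

theorem howardRamdasRadius_nonneg (δ : ℝ) (i : ℕ) : 0 ≤ howardRamdasRadius δ i :=
  mul_nonneg (by norm_num) (Real.sqrt_nonneg _)

variable {δ α : ℝ}

theorem le_measureReal_predictionInterval
    (H : ∀ t, |P.real (Set.Iic t) - empiricalCDF x t| ≤ howardRamdasRadius δ n)
    (hα : α ∈ Set.Ioo (0 : ℝ) 1) :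
    1 - α ≤ P.real (predictionInterval δ x α) := by
  have hg := howardRamdasRadius_nonneg δ n
  have h1 := measureReal_coe_lt_upperQuantile_le H (p := α / 2 - howardRamdasRadius δ n)
    (by linarith [hα.1])
  have h2 := measureReal_lowerQuantile_lt_coe_le H (p := 1 - α / 2 + howardRamdasRadius δ n)
    (by linarith [hα.2]) (by linarith [hα.1])
  have h3 := probReal_compl_eq_one_sub (μ := P) (measurableSet_predictionInterval δ x α)
  rw [compl_predictionInterval] at h3
  have h4 := measureReal_union_le (μ := P)
    {z : ℝ | (z : EReal) < empUpperQuantile x (α / 2 - howardRamdasRadius δ n)}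
    {z : ℝ | empLowerQuantile x (1 - α / 2 + howardRamdasRadius δ n) < (z : EReal)}
  linarith

/-- For a > 0 in the defining set, the lower quantile q at a/2 + g is finite and F(q) ≥ F̂(q) - g ≥
a/2, while (-∞, q] lies in the left miss. -/
theorem levelLower_le
    (H : ∀ t, |P.real (Set.Iic t) - empiricalCDF x t| ≤ howardRamdasRadius δ n) :
    levelLower δ x α ≤
      2 * P.real {z : ℝ | (z : EReal) < empUpperQuantile x (α / 2 - howardRamdasRadius δ n)} := by
  refine Real.sSup_le ?_ (by positivity)
  rintro a ⟨ha, hlt⟩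
  -- The quantile lemma needs a positive level, and only g ≥ 0 is known, so a = 0 is separate.
  rcases ha.1.eq_or_lt with rfl | ha0
  · positivity
  have hg := howardRamdasRadius_nonneg δ n
  obtain ⟨q, hq, hle⟩ := exists_le_empiricalCDF_of_lowerQuantile_lt_top x
    (p := a / 2 + howardRamdasRadius δ n) (by linarith) (hlt.trans_le le_top)
  have hsub : Set.Iic q ⊆
      {z : ℝ | (z : EReal) < empUpperQuantile x (α / 2 - howardRamdasRadius δ n)} := by
    intro z hz
    rw [hq] at hlt
    exact (EReal.coe_le_coe_iff.2 hz).trans_lt hlt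
  have h1 := measureReal_mono (μ := P) hsub
  linarith [(abs_le.1 (H q)).1]

/-- The strict inequality of quantiles yields a real t above the right end of the interval with
F̂(t) ≤ 1 - a/2 - g, so the right miss contains (t, ∞), of probability at least a/2. -/
theorem levelUpper_le
    (H : ∀ t, |P.real (Set.Iic t) - empiricalCDF x t| ≤ howardRamdasRadius δ n) :
    levelUpper δ x α ≤
      2 * P.real
        {z : ℝ | empLowerQuantile x (1 - α / 2 + howardRamdasRadius δ n) < (z : EReal)} := by
  refine Real.sSup_le ?_ (by positivity)
  rintro a ⟨ha, hlt⟩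
  obtain ⟨_, ⟨t, ht, rfl⟩, hqt⟩ := lt_sSup_iff.1 hlt
  have hsub : Set.Ioi t ⊆
      {z : ℝ | empLowerQuantile x (1 - α / 2 + howardRamdasRadius δ n) < (z : EReal)} := by
    intro z hz
    exact ((lowerQuantile_le_upperQuantile _ _).trans_lt hqt).trans (EReal.coe_lt_coe_iff.2 hz)
  have h1 := measureReal_mono (μ := P) hsub
  rw [measureReal_Ioi_eq] at h1
  have ht' : empiricalCDF x t ≤ 1 - a / 2 - howardRamdasRadius δ n := ht
  linarith [(abs_le.1 (H t)).2]

theorem measureReal_predictionInterval_le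
    (H : ∀ t, |P.real (Set.Iic t) - empiricalCDF x t| ≤ howardRamdasRadius δ n)
    (hα : α ∈ Set.Ioo (0 : ℝ) 1) :
    P.real (predictionInterval δ x α) ≤ 1 - levelStar δ x α := by
  have hg := howardRamdasRadius_nonneg δ n
  have h1 := levelLower_le (α := α) H
  have h2 := levelUpper_le (α := α) H
  have h3 := probReal_compl_eq_one_sub (μ := P) (measurableSet_predictionInterval δ x α)
  have hdisj : Disjoint
      {z : ℝ | (z : EReal) < empUpperQuantile x (α / 2 - howardRamdasRadius δ n)}
      {z : ℝ | empLowerQuantile x (1 - α / 2 + howardRamdasRadius δ n) < (z : EReal)} := by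
    refine Set.disjoint_left.2 fun z hz1 hz2 => ?_
    -- The levels are ordered, α/2 - g < 1 - α/2 + g, because α < 1 and g ≥ 0.
    have hle : empUpperQuantile x (α / 2 - howardRamdasRadius δ n) ≤
        empLowerQuantile x (1 - α / 2 + howardRamdasRadius δ n) :=
      upperQuantile_le_lowerQuantile _ (by linarith [hα.2])
    exact lt_irrefl _ ((lt_trans hz1 (hle.trans_lt hz2)))
  rw [compl_predictionInterval, measureReal_union hdisj
    (measurableSet_lt measurable_const measurable_coe_real_ereal)] at h3
  have h4 : levelStar δ x α ≤ levelLower δ x α := min_le_left _ _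
  have h5 : levelStar δ x α ≤ levelUpper δ x α := min_le_right _ _
  linarith

end Coverage

/-! ### Countable chains, all times, and the two half-line chains. -/

theorem visitDeficit_Iic {Ω : Type*} (P : Measure ℝ) (Z : ℕ → Ω → ℝ) (t : ℝ) (i : ℕ) (ω : Ω) :
    visitDeficit P Z (Set.Iic t) i ω = ((i + 1 : ℕ) : ℝ) *
      (P.real (Set.Iic t) - empiricalCDF (fun j : Fin (i + 1) => Z j ω) t) := by
  have h : ((i + 1 : ℕ) : ℝ) ≠ 0 := by positivity
  rw [visitDeficit, Finset.sum_sub_distrib, Finset.sum_const, Finset.card_range, nsmul_eq_mul,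
    Finset.sum_range, empiricalCDF]
  field_simp

theorem visitDeficit_Ioi {Ω : Type*} (P : Measure ℝ) [IsProbabilityMeasure P] (Z : ℕ → Ω → ℝ)
    (t : ℝ) (i : ℕ) (ω : Ω) : visitDeficit P Z (Set.Ioi t) i ω = -visitDeficit P Z (Set.Iic t) i ω := by
  rw [visitDeficit, visitDeficit, ← Finset.sum_neg_distrib]
  refine Finset.sum_congr rfl fun j _ => ?_
  rw [measureReal_Ioi_eq]
  by_cases h : Z j ω ≤ t
  · rw [Set.indicator_of_mem (Set.mem_Iic.2 h), Set.indicator_of_notMem (by simpa using h)]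
    ring
  · rw [Set.indicator_of_mem (Set.mem_Ioi.2 (not_le.1 h)),
      Set.indicator_of_notMem (s := Set.Iic t) h]
    ring

section TimeUniform

variable {Ω : Type*} [MeasurableSpace Ω] {μ : Measure Ω} [IsProbabilityMeasure μ]
  {P : Measure ℝ} [IsProbabilityMeasure P] {Z : ℕ → Ω → ℝ} {δ : ℝ}

/-- A time-uniform deviation bound for the frequencies of the sets of a countable chain of sets of
probability less than one. -/
theorem measure_exists_radius_lt_le_of_lt_one {ι : Type*} [LinearOrder ι] [Countable ι]
    {A : ι → Set ℝ} (hδ : δ ∈ Set.Ioo (0 : ℝ) 1) (hZ : ∀ n, Measurable (Z n))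
    (hlaw : ∀ n, μ.map (Z n) = P) (hindep : iIndepFun Z μ) (hA : Monotone A)
    (hm : ∀ k, MeasurableSet (A k)) (hp : ∀ k, P.real (A k) < 1) :
    μ {ω | ∃ i l, ((i + 1 : ℕ) : ℝ) * howardRamdasRadius δ (i + 1) <
        visitDeficit P Z (A l) i ω} ≤ ENNReal.ofReal (δ / 2) := by
  classical
  let B : ℕ × Finset ι → Set Ω := fun q => {ω | ∃ i ≤ q.1, ∃ l : q.2,
    ((i + 1 : ℕ) : ℝ) * howardRamdasRadius δ (i + 1) < visitDeficit P Z (A l) i ω}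
  have hsub : {ω | ∃ i l, ((i + 1 : ℕ) : ℝ) * howardRamdasRadius δ (i + 1) <
        visitDeficit P Z (A l) i ω} ⊆ ⋃ q, B q := by
    rintro ω ⟨i, l, h⟩
    exact Set.mem_iUnion.2 ⟨(i, {l}), i, le_rfl, ⟨l, Finset.mem_singleton_self l⟩, h⟩
  have hmono : Monotone B := by
    rintro ⟨T, s⟩ ⟨T', s'⟩ h ω ⟨i, hi, ⟨l, hl⟩, hω⟩
    exact ⟨i, hi.trans h.1, ⟨l, h.2 hl⟩, hω⟩
  refine (measure_mono hsub).trans ?_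
  -- The bounds hold uniformly over finite horizons and finite subchains, so they pass to the
  -- increasing union.
  rw [(hmono.directed_le : Directed (· ⊆ ·) B).measure_iUnion]
  refine iSup_le fun q => ?_
  rw [← ofReal_measureReal]
  exact ENNReal.ofReal_le_ofReal (measureReal_exists_radius_lt_le (A := fun l : q.2 => A l) hδ hZ
    hlaw hindep (fun _ _ h => hA h) (fun l => hm l) (fun l => hp l) q.1)

/-- A time-uniform deviation bound for the frequencies of the sets of a countable chain. -/
theorem measure_exists_radius_lt_le {ι : Type*} [LinearOrder ι] [Countable ι]
    {A : ι → Set ℝ} (hδ : δ ∈ Set.Ioo (0 : ℝ) 1) (hZ : ∀ n, Measurable (Z n))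
    (hlaw : ∀ n, μ.map (Z n) = P) (hindep : iIndepFun Z μ) (hA : Monotone A)
    (hm : ∀ k, MeasurableSet (A k)) :
    μ {ω | ∃ i l, ((i + 1 : ℕ) : ℝ) * howardRamdasRadius δ (i + 1) <
        visitDeficit P Z (A l) i ω} ≤ ENNReal.ofReal (δ / 2) := by
  have hnull : μ {ω | ∃ (l : {l // P.real (A l) = 1}) (j : ℕ), Z j ω ∉ A l} = 0 := by
    have : {ω | ∃ (l : {l // P.real (A l) = 1}) (j : ℕ), Z j ω ∉ A l} =
        ⋃ (l : {l // P.real (A l) = 1}) (j : ℕ), Z j ⁻¹' (A l)ᶜ := by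
      ext ω
      simp
    rw [this]
    refine measure_iUnion_null fun l => measure_iUnion_null fun j => ?_
    rw [← Measure.map_apply (hZ j) (hm l).compl, hlaw, prob_compl_eq_zero_iff (hm l)]
    rw [← ofReal_measureReal (s := A l), l.2, ENNReal.ofReal_one]
  have hsub : {ω | ∃ i l, ((i + 1 : ℕ) : ℝ) * howardRamdasRadius δ (i + 1) <
        visitDeficit P Z (A l) i ω} ⊆
      {ω | ∃ (i : ℕ) (l : {l // P.real (A l) < 1}),
        ((i + 1 : ℕ) : ℝ) * howardRamdasRadius δ (i + 1) < visitDeficit P Z (A l) i ω} ∪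
      {ω | ∃ (l : {l // P.real (A l) = 1}) (j : ℕ), Z j ω ∉ A l} := by
    rintro ω ⟨i, l, h⟩
    rcases (measureReal_le_one (μ := P) (s := A l)).lt_or_eq with hl | hl
    · exact Or.inl ⟨i, ⟨l, hl⟩, h⟩
    -- Tilting is undefined for a set of probability one, but then off a null set every observation
    -- is in it and its deficit vanishes.
    · refine Or.inr ⟨⟨l, hl⟩, ?_⟩
      by_contra! hall
      have h0 : visitDeficit P Z (A l) i ω = 0 :=
        Finset.sum_eq_zero fun j _ => by rw [Set.indicator_of_mem (hall j), hl, sub_self]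
      rw [h0] at h
      exact absurd h (not_lt.2 (mul_nonneg (Nat.cast_nonneg _) (howardRamdasRadius_nonneg _ _)))
  refine (measure_mono hsub).trans ((measure_union_le _ _).trans ?_)
  rw [hnull, add_zero]
  exact measure_exists_radius_lt_le_of_lt_one (A := fun l : {l // P.real (A l) < 1} => A l)
    hδ hZ hlaw hindep (fun _ _ h => hA h) (fun l => hm l) (fun l => l.2)

open Filter Topology in
/-- A uniform bound at the rationals between a distribution function and an empirical distribution
function extends to all reals. -/
theorem abs_sub_empiricalCDF_le_of_rat {n : ℕ} {x : Fin n → ℝ} {g : ℝ}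
    (H : ∀ q : ℚ, |P.real (Set.Iic (q : ℝ)) - empiricalCDF x q| ≤ g) (t : ℝ) :
    |P.real (Set.Iic t) - empiricalCDF x t| ≤ g := by
  have hright : Tendsto (fun s => P.real (Set.Iic s) - empiricalCDF x s) (𝓝[>] t)
      (𝓝 (P.real (Set.Iic t) - empiricalCDF x t)) := by
    refine Tendsto.sub ?_ (tendsto_nhds_of_eventually_eq (eventually_empiricalCDF_eq x t))
    have := ((cdf P).right_continuous t).mono_left (nhdsWithin_mono t Set.Ioi_subset_Ici_self)
    rw [show (fun s => P.real (Set.Iic s)) = cdf P from funext fun s => (cdf_eq_real P s).symm,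
      ← cdf_eq_real]
    exact this
  have hfreq : ∃ᶠ s in 𝓝[>] t, |P.real (Set.Iic s) - empiricalCDF x s| ≤ g := by
    rw [(nhdsGT_basis t).frequently_iff]
    intro b hb
    obtain ⟨q, hq1, hq2⟩ := exists_rat_btwn hb
    exact ⟨q, ⟨hq1, hq2⟩, H q⟩
  exact isClosed_Iic.mem_of_frequently_of_tendsto hfreq hright.abs

end TimeUniform

theorem theorem2 {Ω : Type*} [MeasurableSpace Ω] (μ : Measure Ω) [IsProbabilityMeasure μ]
    (P : Measure ℝ) [IsProbabilityMeasure P]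
    (Z : ℕ → Ω → ℝ) (hlaw : ∀ n, HasLaw (Z n) P μ) (hindep : iIndepFun Z μ)
    (δ : ℝ) (hδ : δ ∈ Set.Ioo (0 : ℝ) 1) :
    ∃ E : Set Ω, MeasurableSet E ∧ 1 - δ ≤ μ.real E ∧
      ∀ ω ∈ E, ∀ i : ℕ, 1 ≤ i → ∀ α ∈ Set.Ioo (0 : ℝ) 1,
        1 - α ≤ P.real (predictionInterval δ (fun j : Fin i => Z j ω) α) ∧
        P.real (predictionInterval δ (fun j : Fin i => Z j ω) α) ≤
          1 - levelStar δ (fun j : Fin i => Z j ω) α := by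
  -- `HasLaw` gives only almost everywhere measurability; the martingale argument runs on measurable
  -- versions, and `N` collects the exceptions.
  let Y : ℕ → Ω → ℝ := fun n => (hlaw n).aemeasurable.mk
  have hYZ : ∀ n, Z n =ᵐ[μ] Y n := fun n => (hlaw n).aemeasurable.ae_eq_mk
  have hY : ∀ n, Measurable (Y n) := fun n => (hlaw n).aemeasurable.measurable_mk
  have hYlaw : ∀ n, μ.map (Y n) = P := fun n => by
    rw [← Measure.map_congr (hYZ n), (hlaw n).map_eq]
  have hYindep : iIndepFun Y μ := hindep.congr hYZ
  let N : Set Ω := {ω | ¬ ∀ n, Z n ω = Y n ω}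
  have hN : μ N = 0 := ae_iff.1 (ae_all_iff.2 hYZ)
  let B₁ : Set Ω := {ω | ∃ (i : ℕ) (q : ℚ), ((i + 1 : ℕ) : ℝ) * howardRamdasRadius δ (i + 1) <
    visitDeficit P Y (Set.Iic (q : ℝ)) i ω}
  -- Upper half-lines grow as the threshold decreases, hence the order dual as index of the chain.
  let B₂ : Set Ω := {ω | ∃ (i : ℕ) (q : ℚᵒᵈ), ((i + 1 : ℕ) : ℝ) * howardRamdasRadius δ (i + 1) <
    visitDeficit P Y (Set.Ioi ((OrderDual.ofDual q : ℚ) : ℝ)) i ω}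
  have hB₁ : μ B₁ ≤ ENNReal.ofReal (δ / 2) :=
    measure_exists_radius_lt_le (A := fun q : ℚ => Set.Iic (q : ℝ)) hδ hY hYlaw hYindep
      (fun _ _ h => Set.Iic_subset_Iic.2 (Rat.cast_le.2 h)) fun _ => measurableSet_Iic
  have : Countable ℚᵒᵈ := inferInstanceAs (Countable ℚ)
  have hB₂ : μ B₂ ≤ ENNReal.ofReal (δ / 2) :=
    measure_exists_radius_lt_le (A := fun q : ℚᵒᵈ => Set.Ioi ((OrderDual.ofDual q : ℚ) : ℝ))
      hδ hY hYlaw hYindep (fun _ _ h => Set.Ioi_subset_Ioi (Rat.cast_le.2 h))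
      fun _ => measurableSet_Ioi
  have hBad : μ (toMeasurable μ (B₁ ∪ B₂ ∪ N)) ≤ ENNReal.ofReal δ := by
    rw [measure_toMeasurable]
    calc μ (B₁ ∪ B₂ ∪ N) ≤ μ B₁ + μ B₂ + μ N :=
          (measure_union_le _ _).trans (add_le_add_left (measure_union_le _ _) _)
      _ ≤ ENNReal.ofReal (δ / 2) + ENNReal.ofReal (δ / 2) + 0 := by
          rw [hN]
          gcongr
      _ = ENNReal.ofReal δ := by
          have := hδ.1
          rw [add_zero, ← ENNReal.ofReal_add (by linarith) (by linarith), add_halves]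
  refine ⟨(toMeasurable μ (B₁ ∪ B₂ ∪ N))ᶜ, (measurableSet_toMeasurable _ _).compl, ?_, ?_⟩
  · rw [probReal_compl_eq_one_sub (measurableSet_toMeasurable _ _)]
    have := ENNReal.toReal_le_of_le_ofReal hδ.1.le hBad
    exact sub_le_sub_left this 1
  · intro ω hω i hi α hα
    obtain ⟨i, rfl⟩ := Nat.exists_eq_succ_of_ne_zero (Nat.one_le_iff_ne_zero.1 hi)
    have hω' : ω ∉ B₁ ∪ B₂ ∪ N := fun h => hω (subset_toMeasurable _ _ h)
    simp only [Set.mem_union, not_or] at hω'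
    obtain ⟨⟨h₁, h₂⟩, h₃⟩ := hω'
    have hZY : ∀ n, Z n ω = Y n ω := not_not.1 h₃
    have hfun : (fun j : Fin (i + 1) => Z j ω) = fun j : Fin (i + 1) => Y j ω :=
      funext fun j => hZY j
    have hi0 : (0 : ℝ) < ((i + 1 : ℕ) : ℝ) := by positivity
    have H : ∀ t, |P.real (Set.Iic t) - empiricalCDF (fun j : Fin (i + 1) => Y j ω) t| ≤
        howardRamdasRadius δ (i + 1) := by
      refine abs_sub_empiricalCDF_le_of_rat fun q => abs_le.2 ⟨?_, ?_⟩
      · have h := not_lt.1 fun h => h₂ ⟨i, OrderDual.toDual q, h⟩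
        rw [OrderDual.ofDual_toDual, visitDeficit_Ioi, visitDeficit_Iic, ← mul_neg] at h
        linarith [le_of_mul_le_mul_left h hi0]
      · have h := not_lt.1 fun h => h₁ ⟨i, q, h⟩
        rw [visitDeficit_Iic] at h
        exact le_of_mul_le_mul_left h hi0
    simp only [Nat.succ_eq_add_one, hfun]
    exact ⟨le_measureReal_predictionInterval H hα, measureReal_predictionInterval_le H hα⟩
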